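/- Let $u=(u_1,u_2,u_3)\in (C^2(\mathbb R^3)\cap L^2(\mathbb R^3))^3$ be a divergence-free real vector field and let $p\in C^2(\mathbb R^3)$ be a real-valued classical solution of $$-\Delta p=\sum_{i,j=1}^3\partial_i\partial_j(u_iu_j)\quad\text{in }\mathbb R^3 .$$ For $x\in\mathbb R^3$ and $\rho>0$ let $\overline p(x,\rho)=\frac1{4\pi}\int_{|\xi|=1}p(x+\rho\xi)\,dS(\xi)$ be the mean of $p$ over the sphere of radius $\rho$ about $x$. Write $\hat z=z/|z|$ for $z\neq0$, $\sigma_{ij}(\xi)=3\xi_i\xi_j-\delta_{ij}$ for $|\xi|=1$, and let $w(\lambda)=1$ for $0\le\lambda\le1$, $w(\lambda)=2-\lambda$ for $1\le\lambda\le2$, $w(\lambda)=0$ for $\lambda\ge2$. Then for every $x\in\mathbb R^3$ and every $r>0$, $$p(x)=\beta(x,r)+\pi(x,r),$$ where $$\beta(x,r)=\frac1r\int_r^{2r}\overline p(x,\rho)\,d\rho$$ and $$\begin{aligned}\pi(x,r)={}&\frac1{4\pi r}\int_{r\le|y-x|\le2r}\frac1{|y-x|^2}\Big(\widehat{y-x}\cdot(u(y)-u(x))\Big)^2dy\\&+\frac1{4\pi}\int_{|x-y|\le2r}w\Big(\frac{|y-x|}r\Big)\sum_{i,j=1}^3\frac{\sigma_{ij}(\widehat{x-y})}{|x-y|^3}\,(u_i(y)-u_i(x))(u_j(y)-u_j(x))\,dy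 ,\end{aligned}$$ and the radial integral defining $\beta$ and the two integrals defining $\pi$ converge absolutely. -/

import Mathlib

open MeasureTheory

namespace LocalPressure

noncomputable section

/-- Three-dimensional Euclidean space. -/
abbrev R3 : Type := EuclideanSpace ℝ (Fin 3)

/-- The partial derivative of a scalar function in the `i`-th coordinate direction. -/
def partialDeriv (i : Fin 3) (f : R3 → ℝ) (x : R3) : ℝ :=
  fderiv ℝ f x (EuclideanSpace.single i 1)

/-- The divergence of a vector field. -/
def divergence (u : R3 → R3) (x : R3) : ℝ :=
  ∑ i, partialDeriv i (fun y => u y i) x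

/-- `p` is a classical solution of `-Δ p = ∂ᵢ ∂ⱼ (uᵢ uⱼ)` on the whole space. -/
def IsPressure (u : R3 → R3) (p : R3 → ℝ) : Prop :=
  ContDiff ℝ 2 p ∧
    ∀ x, -Laplacian.laplacian p x =
      ∑ i, ∑ j, partialDeriv i (partialDeriv j (fun y => u y i * u y j)) x

/-- The mean of `f` over the sphere of radius `r` about `x`, i.e. the normalized integral of
`f (x + r ξ)` over the unit sphere with respect to surface measure. -/
def sphericalMean (f : R3 → ℝ) (x : R3) (r : ℝ) : ℝ :=
  ⨍ ξ : Metric.sphere (0 : R3) 1, f (x + r • (ξ : R3)) ∂(volume : Measure R3).toSphere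

/-- The radial average `β(x, r)` of the spherical means over radii in `[r, 2r]`. -/
def radialAverage (p : R3 → ℝ) (x : R3) (r : ℝ) : ℝ :=
  (1 / r) * ∫ ρ in r..(2 * r), sphericalMean p x ρ

/-- The unit vector `z / |z|` (and `0` for `z = 0`). -/
def unitVec (z : R3) : R3 := ‖z‖⁻¹ • z

/-- `σᵢⱼ(ξ) = 3 ξᵢ ξⱼ - δᵢⱼ`, for unit vectors `ξ`. -/
def sigma (i j : Fin 3) (ξ : R3) : ℝ := 3 * ξ i * ξ j - if i = j then 1 else 0

/-- The weight on `[0, ∞)`: `1` on `[0, 1]`, `2 - t` on `[1, 2]`, `0` on `[2, ∞)`. -/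
def weight (t : ℝ) : ℝ := if t ≤ 1 then 1 else if t ≤ 2 then 2 - t else 0

/-- The closed annulus `r ≤ |y - x| ≤ 2r`. -/
def annulus (x : R3) (r : ℝ) : Set R3 := {y | r ≤ ‖y - x‖ ∧ ‖y - x‖ ≤ 2 * r}

/-- The integrand of the annulus term of `π(x, r)`. -/
def annulusIntegrand (u : R3 → R3) (x y : R3) : ℝ :=
  1 / ‖y - x‖ ^ 2 * (inner ℝ (unitVec (y - x)) (u y - u x)) ^ 2

/-- The integrand of the ball term of `π(x, r)`. -/
def ballIntegrand (u : R3 → R3) (x : R3) (r : ℝ) (y : R3) : ℝ :=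
  weight (‖y - x‖ / r) *
    ∑ i, ∑ j, sigma i j (unitVec (x - y)) / ‖x - y‖ ^ 3 * ((u y i - u x i) * (u y j - u x j))

/-- The term `π(x, r)`, built from the velocity increments at distance at most `2r`. -/
def incrementTerm (u : R3 → R3) (x : R3) (r : ℝ) : ℝ :=
  1 / (4 * Real.pi * r) * (∫ y in annulus x r, annulusIntegrand u x y) +
    1 / (4 * Real.pi) * ∫ y in Metric.closedBall x (2 * r), ballIntegrand u x r y

end

end LocalPressure

open MeasureTheory Filter Topology Set
open scoped NNReal

namespace LocalPressure

/-! Put `V z = u (x + z) - u x` and `q z = p (x + z)`. Because `u` is divergence-free, subtracting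
the constant `u x` does not change the double divergence of `u ⊗ u`, so the pressure equation says
that `T = V ⊗ V + q I` has double divergence zero (`sum_partialDeriv_stress_eq_zero`). Hence `T` is
orthogonal to the Hessian of any compactly supported test function regular enough for two
integrations by parts.

The test function is a truncated Newtonian potential `Φ` with `∇Φ = -k(|z|) z` and `k(s) = w(s/r) /
max(s, ε)^3`; its Hessian is `-(k δᵢⱼ + k' zᵢ zⱼ / |z|)`. Three regions contribute. For `|z| < ε`,
`k` is constant and the pairing sees `ε⁻³ (|V|² + 3q)`, whose integral tends to `4π q(0)` since `V 0
= 0`. For `ε < |z| < 2r`, the part with `w` undifferentiated is the Hessian of the Newtonian kernel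
times `w`: it is trace-free, so `q` drops out and the ball integrand remains. For `r < |z| < 2r`,
the slope `w' = -1/r` adds a radial term, giving the annulus integral of `V` and that of `q / |z|²`;
in polar coordinates the latter is the radial average of spherical means.

This is `regularized_representation`. Letting `ε → 0` gives `centred_representation`; the limit
exists because `V` is Lipschitz near `0`, so the ball integrand is `O(1/|z|)`. -/

/-- The standard basis vector in the `i`-th direction. -/
noncomputable abbrev basisVec (i : Fin 3) : R3 := EuclideanSpace.single i 1

/-! ### Integration by parts for Lipschitz test functions -/

theorem lineDeriv_basisVec_eq_partialDeriv {f : R3 → ℝ} {x : R3} (i : Fin 3)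
    (hf : DifferentiableAt ℝ f x) : lineDeriv ℝ f x (basisVec i) = partialDeriv i f x :=
  hf.lineDeriv_eq_fderiv

theorem contDiff_partialDeriv {n : ℕ} {f : R3 → ℝ} (hf : ContDiff ℝ (n + 1) f) (i : Fin 3) :
    ContDiff ℝ n (partialDeriv i f) :=
  (hf.fderiv_right (m := n) le_rfl).clm_apply contDiff_const

/-- Integration by parts of a compactly supported Lipschitz function against a `C¹` function. -/
theorem integral_mul_partialDeriv_eq {g f : R3 → ℝ} {C : ℝ≥0} (hg : LipschitzWith C g)
    (hgc : HasCompactSupport g) (hf : ContDiff ℝ 1 f) (i : Fin 3) :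
    ∫ z, g z * partialDeriv i f z = -∫ z, lineDeriv ℝ g z (basisVec i) * f z := by
  obtain ⟨R, hR0, hR⟩ : ∃ R : ℝ, 0 < R ∧ tsupport g ⊆ Metric.ball 0 R := by
    obtain ⟨R, hR⟩ := hgc.isCompact.isBounded.subset_ball 0
    exact ⟨max R 1, by positivity, hR.trans (Metric.ball_subset_ball (le_max_left _ _))⟩
  -- Cutting `f` off outside a neighbourhood of the support of `g` makes it globally Lipschitz and
  -- changes neither integral.
  let χ : ContDiffBump (0 : R3) := ⟨R, R + 1, hR0, by linarith⟩
  have hχ : ContDiff ℝ 1 (fun z => χ z * f z) := χ.contDiff.mul hf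
  have hχc : HasCompactSupport (fun z => χ z * f z) := χ.hasCompactSupport.mul_right
  obtain ⟨D, hD⟩ := hχ.lipschitzWith_of_hasCompactSupport hχc (by simp)
  have hloc : ∀ z ∈ tsupport g, (fun z => χ z * f z) =ᶠ[𝓝 z] f := by
    intro z hz
    filter_upwards [Metric.isOpen_ball.mem_nhds (hR hz)] with y hy
    rw [χ.one_of_mem_closedBall (Metric.ball_subset_closedBall hy), one_mul]
  have key := LipschitzWith.integral_lineDeriv_mul_eq (μ := volume) hD hg hgc (basisVec i)
  have h1 : ∀ z, lineDeriv ℝ (fun z => χ z * f z) z (basisVec i) * g z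
      = g z * partialDeriv i f z := by
    intro z
    by_cases hz : z ∈ tsupport g
    · rw [(hloc z hz).lineDeriv_eq,
        lineDeriv_basisVec_eq_partialDeriv i (hf.differentiable one_ne_zero z), mul_comm]
    · rw [image_eq_zero_of_notMem_tsupport hz]; simp
  have h2 : ∀ z, lineDeriv ℝ g z (-basisVec i) * (χ z * f z)
      = -(lineDeriv ℝ g z (basisVec i) * f z) := by
    intro z
    rw [lineDeriv_neg]
    by_cases hz : z ∈ tsupport g
    · rw [(hloc z hz).eq_of_nhds]; ring
    · have : lineDeriv ℝ g z (basisVec i) = 0 := by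
        rw [(notMem_tsupport_iff_eventuallyEq.1 hz).lineDeriv_eq]
        simp [lineDeriv]
      rw [this]; simp
  simp_rw [h1, h2, integral_neg] at key
  exact key

/-! ### The regularized radial kernel -/

/-- Bounded Lipschitz real functions. -/
def IsBoundedLipschitz {X : Type*} [PseudoMetricSpace X] (f : X → ℝ) : Prop :=
  (∃ A, ∀ x, |f x| ≤ A) ∧ ∃ C, LipschitzWith C f

theorem IsBoundedLipschitz.mul {X : Type*} [PseudoMetricSpace X] {f g : X → ℝ}
    (hf : IsBoundedLipschitz f) (hg : IsBoundedLipschitz g) :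
    IsBoundedLipschitz (fun x => f x * g x) := by
  obtain ⟨⟨A, hA⟩, C, hC⟩ := hf
  obtain ⟨⟨B, hB⟩, D, hD⟩ := hg
  refine ⟨⟨A * B, fun x => ?_⟩, _, LipschitzWith.of_dist_le' (K := A * D + B * C) fun x y => ?_⟩
  · rw [abs_mul]
    exact mul_le_mul (hA x) (hB x) (abs_nonneg _) ((abs_nonneg _).trans (hA x))
  · have h1 := hC.dist_le_mul x y
    have h2 := hD.dist_le_mul x y
    rw [Real.dist_eq] at *
    calc |f x * g x - f y * g y| = |f x * (g x - g y) + g y * (f x - f y)| := by ring_nf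
      _ ≤ |f x| * |g x - g y| + |g y| * |f x - f y| := by
        rw [← abs_mul, ← abs_mul]; exact abs_add_le _ _
      _ ≤ A * (D * dist x y) + B * (C * dist x y) := by
        gcongr
        · exact (abs_nonneg _).trans (hA x)
        · exact hA x
        · exact (abs_nonneg _).trans (hB y)
        · exact hB y
      _ = _ := by ring

theorem IsBoundedLipschitz.comp {X Y : Type*} [PseudoMetricSpace X] [PseudoMetricSpace Y]
    {f : Y → ℝ} (hf : IsBoundedLipschitz f) {g : X → Y} {C : ℝ≥0} (hg : LipschitzWith C g) :
    IsBoundedLipschitz (fun x => f (g x)) := by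
  obtain ⟨⟨A, hA⟩, D, hD⟩ := hf
  exact ⟨⟨A, fun x => hA _⟩, _, hD.comp hg⟩

/-- The lattice form makes the bounds and the Lipschitz constant immediate. -/
theorem weight_eq (t : ℝ) : weight t = max 0 (min 1 (2 - t)) := by
  unfold weight
  split_ifs with h1 h2
  · rw [min_eq_left (by linarith)]; simp
  · rw [min_eq_right (by linarith), max_eq_right (by linarith)]
  · rw [min_eq_right (by linarith), max_eq_left (by linarith)]

theorem isBoundedLipschitz_weight : IsBoundedLipschitz weight := by
  refine ⟨⟨1, fun t => ?_⟩, 1, LipschitzWith.of_dist_le_mul fun s t => ?_⟩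
  · rw [weight_eq, abs_of_nonneg (le_max_left _ _)]
    exact max_le zero_le_one (min_le_left _ _)
  · have h0 : LipschitzWith 1 fun t : ℝ => 2 - t := LipschitzWith.of_dist_le_mul fun s t => by
      rw [Real.dist_eq, Real.dist_eq, NNReal.coe_one, one_mul, sub_sub_sub_cancel_left,
        abs_sub_comm]
    have h : LipschitzWith 1 fun t : ℝ => max 0 (min 1 (2 - t)) := (h0.const_min 1).const_max 0
    simpa only [weight_eq] using h.dist_le_mul s t

theorem isBoundedLipschitz_inv_max {ε : ℝ} (hε : 0 < ε) :
    IsBoundedLipschitz (fun s : ℝ => (max s ε)⁻¹) := by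
  have hpos : ∀ s, 0 < max s ε := fun s => lt_max_of_lt_right hε
  refine ⟨⟨ε⁻¹, fun s => ?_⟩, _, LipschitzWith.of_dist_le' (K := ε⁻¹ * ε⁻¹) fun s t => ?_⟩
  · rw [abs_of_pos (inv_pos.2 (hpos s))]
    exact inv_anti₀ hε (le_max_right _ _)
  · have : (max s ε)⁻¹ - (max t ε)⁻¹ = (max t ε - max s ε) * ((max s ε)⁻¹ * (max t ε)⁻¹) := by
      have := (hpos s).ne'; have := (hpos t).ne'; field_simp
    rw [Real.dist_eq, Real.dist_eq, this, abs_mul, mul_comm]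
    have h1 : |max t ε - max s ε| ≤ |s - t| := by
      rw [abs_sub_comm]; exact abs_max_sub_max_le_abs s t ε
    have h2 : |(max s ε)⁻¹ * (max t ε)⁻¹| ≤ ε⁻¹ * ε⁻¹ := by
      rw [abs_of_pos (mul_pos (inv_pos.2 (hpos s)) (inv_pos.2 (hpos t)))]
      have := inv_anti₀ hε (le_max_right s ε)
      have := inv_anti₀ hε (le_max_right t ε)
      gcongr
    gcongr

/-- The regularized radial profile `w(s / r) / max(s, ε) ^ 3`. -/
noncomputable def profile (r ε s : ℝ) : ℝ := weight (s / r) * ((max s ε)⁻¹) ^ 3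

theorem isBoundedLipschitz_profile (r : ℝ) {ε : ℝ} (hε : 0 < ε) :
    IsBoundedLipschitz (profile r ε) := by
  have h1 : IsBoundedLipschitz fun s : ℝ => weight (s / r) :=
    isBoundedLipschitz_weight.comp (C := ‖r⁻¹‖₊) (LipschitzWith.of_dist_le_mul fun s t => by
      rw [Real.dist_eq, Real.dist_eq, ← sub_div, abs_div, div_eq_mul_inv, mul_comm]
      simp)
  have h2 := isBoundedLipschitz_inv_max hε
  have h := h1.mul (h2.mul (h2.mul h2))
  convert h using 2 with s
  rw [profile]; ring

theorem profile_eq_zero {r ε s : ℝ} (hr : 0 < r) (hs : 2 * r ≤ s) : profile r ε s = 0 := by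
  have : 2 ≤ s / r := by rwa [le_div_iff₀ hr]
  rw [profile, weight_eq, max_eq_left ((min_le_right _ _).trans (by linarith)), zero_mul]

theorem continuous_profile (r : ℝ) {ε : ℝ} (hε : 0 < ε) : Continuous (profile r ε) := by
  obtain ⟨-, C, hC⟩ := isBoundedLipschitz_profile r hε
  exact hC.continuous

theorem abs_apply_le_norm (z : R3) (i : Fin 3) : |z i| ≤ ‖z‖ := PiLp.norm_apply_le z i

/-- The field `z ↦ k(|z|) z` built from the regularized profile `k` is Lipschitz. -/
theorem exists_lipschitzWith_profile_mul {r ε : ℝ} (hr : 0 < r) (hε : 0 < ε) (i : Fin 3) :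
    ∃ C, LipschitzWith C fun z : R3 => profile r ε ‖z‖ * z i := by
  have h1 : IsBoundedLipschitz fun z : R3 => profile r ε ‖z‖ :=
    (isBoundedLipschitz_profile r hε).comp lipschitzWith_one_norm
  -- A coordinate is unbounded, so it is truncated at `±2r`; the profile vanishes wherever the
  -- truncation acts.
  have h2 : IsBoundedLipschitz fun z : R3 => max (-(2 * r)) (min (2 * r) (z i)) := by
    refine ⟨⟨2 * r, fun z => abs_le.2 ⟨le_max_left _ _,
      max_le (by linarith) (min_le_left _ _)⟩⟩, 1, ?_⟩
    exact ((LipschitzWith.of_dist_le_mul fun s t => by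
      simpa [Real.dist_eq, dist_eq_norm] using abs_apply_le_norm (s - t) i).const_min _).const_max _
  obtain ⟨-, C, hC⟩ := h1.mul h2
  suffices h : (fun z : R3 => profile r ε ‖z‖ * z i) =
      fun z => profile r ε ‖z‖ * max (-(2 * r)) (min (2 * r) (z i)) from ⟨C, h ▸ hC⟩
  funext z
  rcases le_total (2 * r) ‖z‖ with h | h
  · simp [profile_eq_zero hr h]
  · have := abs_le.1 ((abs_apply_le_norm z i).trans h)
    rw [min_eq_right this.2, max_eq_right this.1]

theorem hasCompactSupport_profile_mul {r ε : ℝ} (hr : 0 < r) (i : Fin 3) :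
    HasCompactSupport fun z : R3 => profile r ε ‖z‖ * z i := by
  refine HasCompactSupport.intro (isCompact_closedBall 0 (2 * r)) fun z hz => ?_
  rw [profile_eq_zero hr (by simpa using (not_le.1 (by simpa using hz)).le), zero_mul]

/-! ### The potential and the orthogonality relation -/

/-- The regularized radial potential whose gradient is `-k(|z|) z`. -/
noncomputable def potential (r ε : ℝ) (z : R3) : ℝ :=
  1 / 2 * ∫ t in ‖z‖ ^ 2..(2 * r) ^ 2, profile r ε √t

/-- Integrating in the variable `t = ‖z‖ ^ 2` makes the potential a function of the smooth squared
norm, so the origin needs no separate treatment. -/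
theorem hasFDerivAt_potential (r : ℝ) {ε : ℝ} (hε : 0 < ε) (z : R3) :
    HasFDerivAt (potential r ε) (-(profile r ε ‖z‖) • innerSL ℝ z) z := by
  have hc : Continuous fun t : ℝ => profile r ε √t :=
    (continuous_profile r hε).comp Real.continuous_sqrt
  have h1 : HasDerivAt (fun q : ℝ => ∫ t in q..(2 * r) ^ 2, profile r ε √t)
      (-profile r ε √(‖z‖ ^ 2)) (‖z‖ ^ 2) :=
    intervalIntegral.integral_hasDerivAt_left (hc.intervalIntegrable _ _)
      (hc.stronglyMeasurableAtFilter _ _) hc.continuousAt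
  have h2 := (h1.comp_hasFDerivAt z (hasStrictFDerivAt_norm_sq z).hasFDerivAt).const_mul (1 / 2)
  rw [Real.sqrt_sq (norm_nonneg z)] at h2
  refine h2.congr_fderiv ?_
  ext v
  simp
  ring

theorem hasCompactSupport_potential {r ε : ℝ} (hr : 0 < r) :
    HasCompactSupport (potential r ε) := by
  refine HasCompactSupport.intro (isCompact_closedBall 0 (2 * r)) fun z hz => ?_
  have hz' : 2 * r ≤ ‖z‖ := by simpa using (not_le.1 (by simpa using hz)).le
  rw [potential, intervalIntegral.integral_congr (g := fun _ => (0 : ℝ))]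
  · simp
  · intro t ht
    -- Outside the ball the limits are reversed, and the whole interval lies where the profile is
    -- zero.
    rw [uIcc_of_ge (by gcongr)] at ht
    exact profile_eq_zero hr (Real.le_sqrt_of_sq_le ht.1)

theorem contDiff_potential (r : ℝ) {ε : ℝ} (hε : 0 < ε) : ContDiff ℝ 1 (potential r ε) := by
  refine contDiff_one_iff_hasFDerivAt.2 ⟨_, ?_, hasFDerivAt_potential r hε⟩
  exact ((continuous_profile r hε).comp continuous_norm).neg.smul (innerSL ℝ).continuous

theorem lineDeriv_potential (r : ℝ) {ε : ℝ} (hε : 0 < ε) (z : R3) (i : Fin 3) :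
    lineDeriv ℝ (potential r ε) z (basisVec i) = -(profile r ε ‖z‖ * z i) := by
  rw [((hasFDerivAt_potential r hε z).hasLineDerivAt _).lineDeriv]
  simp [EuclideanSpace.inner_single_right]

/-- A tensor field with vanishing double divergence is orthogonal to the Hessian of the
regularized potential. -/
theorem sum_integral_lineDeriv_profile_mul_eq_zero {r ε : ℝ} (hr : 0 < r) (hε : 0 < ε)
    {T : Fin 3 → Fin 3 → R3 → ℝ} (hT : ∀ i j, ContDiff ℝ 2 (T i j))
    (hdiv : ∀ z, ∑ i, ∑ j, partialDeriv i (partialDeriv j (T i j)) z = 0) :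
    ∑ i, ∑ j, ∫ z, lineDeriv ℝ (fun z : R3 => profile r ε ‖z‖ * z i) z (basisVec j) * T i j z
      = 0 := by
  have hT' : ∀ i j, ContDiff ℝ 1 (partialDeriv j (T i j)) := fun i j =>
    contDiff_partialDeriv (n := 1) (hT i j) j
  obtain ⟨C, hC⟩ := (contDiff_potential r hε).lipschitzWith_of_hasCompactSupport
    (hasCompactSupport_potential hr) one_ne_zero
  -- The first integration by parts moves `∂ⱼ` onto `T i j`; the second uses that `k(|z|) zᵢ` is
  -- minus the `i`-th derivative of the potential.
  have h1 : ∀ i j, ∫ z, lineDeriv ℝ (fun z : R3 => profile r ε ‖z‖ * z i) z (basisVec j) * T i j z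
      = -∫ z, potential r ε z * partialDeriv i (partialDeriv j (T i j)) z := by
    intro i j
    obtain ⟨D, hD⟩ := exists_lipschitzWith_profile_mul hr hε i
    have a := integral_mul_partialDeriv_eq hD (hasCompactSupport_profile_mul hr i)
      ((hT i j).of_le one_le_two) j
    have b := integral_mul_partialDeriv_eq hC (hasCompactSupport_potential hr) (hT' i j) i
    simp_rw [lineDeriv_potential r hε, neg_mul, integral_neg] at b
    linarith
  have hint : ∀ i j, Integrable
      fun z => potential r ε z * partialDeriv i (partialDeriv j (T i j)) z := fun i j =>
    ((contDiff_potential r hε).continuous.mul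
      (contDiff_partialDeriv (n := 0) (hT' i j) i).continuous).integrable_of_hasCompactSupport
      (hasCompactSupport_potential hr).mul_right
  simp_rw [h1, Finset.sum_neg_distrib]
  rw [neg_eq_zero]
  simp_rw [← integral_finsetSum _ fun j _ => hint _ j]
  rw [← integral_finsetSum _ fun i _ => integrable_finsetSum _ fun j _ => hint i j]
  simp_rw [← Finset.mul_sum, hdiv]
  simp

/-- The derivative of a Lipschitz function need not be continuous, but it is bounded, measurable and
zero off the compact support. -/
theorem integrable_lineDeriv_mul {g f : R3 → ℝ} {C : ℝ≥0} (hg : LipschitzWith C g)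
    (hgc : HasCompactSupport g) (hf : Continuous f) (v : R3) :
    Integrable fun z => lineDeriv ℝ g z v * f z := by
  have h1 : Integrable ((tsupport g).indicator f) :=
    (hf.continuousOn.integrableOn_compact hgc.isCompact).integrable_indicator
      (isClosed_tsupport g).measurableSet
  have h2 := h1.bdd_mul (f := fun z => lineDeriv ℝ g z v)
    (measurable_lineDeriv hg.continuous).aestronglyMeasurable
    (ae_of_all _ fun z => norm_lineDeriv_le_of_lipschitz ℝ hg)
  refine h2.congr (ae_of_all _ fun z => ?_)
  by_cases hz : z ∈ tsupport g
  · simp [hz]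
  · have : lineDeriv ℝ g z v = 0 := by
      rw [(notMem_tsupport_iff_eventuallyEq.1 hz).lineDeriv_eq]
      simp [lineDeriv]
    simp [this]

/-! ### Pointwise computation of the Hessian pairing -/

/-- The derivative of a radial multiple of a coordinate function. -/
theorem lineDeriv_radial_mul {h : ℝ → ℝ} {h' : ℝ} {z : R3} (hz : z ≠ 0)
    (hh : HasDerivAt h h' ‖z‖) (i j : Fin 3) :
    lineDeriv ℝ (fun z : R3 => h ‖z‖ * z i) z (basisVec j)
      = h' / ‖z‖ * (z i * z j) + h ‖z‖ * (if i = j then 1 else 0) := by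
  have hpos : 0 < ‖z‖ := norm_pos_iff.2 hz
  have h0 : HasDerivAt (fun t : ℝ => z + t • basisVec j) (basisVec j) 0 := by
    simpa using ((hasDerivAt_id (0 : ℝ)).smul_const (basisVec j)).const_add z
  have h1 : HasDerivAt (fun t : ℝ => ‖z + t • basisVec j‖ ^ 2) (2 * z j) 0 := by
    simpa [EuclideanSpace.inner_single_right] using h0.norm_sq
  have h2 : HasDerivAt (fun t : ℝ => ‖z + t • basisVec j‖) (z j / ‖z‖) 0 := by
    have h3 := h1.sqrt (by simpa using hz)
    simp only [zero_smul, add_zero, Real.sqrt_sq (norm_nonneg _)] at h3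
    convert h3 using 1
    field_simp
  have h4 : HasDerivAt (fun t : ℝ => (z + t • basisVec j) i) (if i = j then 1 else 0) 0 := by
    have := ((hasDerivAt_id (0 : ℝ)).mul_const (basisVec j i)).const_add (z i)
    simpa [Pi.single_apply] using this
  have hh' : HasDerivAt h h' ‖z + (0 : ℝ) • basisVec j‖ := by simpa using hh
  have h5 := (hh'.comp (0 : ℝ) h2).mul h4
  refine (HasDerivAt.deriv h5).trans ?_
  simp
  ring

/-- The derivative of the regularized profile, away from its corners. -/
noncomputable def profileDeriv (r ε s : ℝ) : ℝ :=
  if s < ε then 0 else if s < r then -3 / s ^ 4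
  else if s < 2 * r then -(1 / r) / s ^ 3 - 3 * (2 - s / r) / s ^ 4 else 0

theorem profile_of_lt {r ε s : ℝ} (hr : 0 < r) (hεr : ε < r) (hs : s < ε) :
    profile r ε s = (ε⁻¹) ^ 3 := by
  rw [profile, max_eq_right hs.le, weight, if_pos ((div_le_one hr).2 (by linarith)), one_mul]

theorem profile_of_le {r ε s : ℝ} (hs : ε ≤ s) :
    profile r ε s = weight (s / r) / s ^ 3 := by
  rw [profile, max_eq_left hs, inv_pow, ← div_eq_mul_inv]

theorem hasDerivAt_profile {r ε s : ℝ} (hε : 0 < ε) (hεr : ε < r)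
    (h1 : s ≠ ε) (h2 : s ≠ r) (h3 : s ≠ 2 * r) :
    HasDerivAt (profile r ε) (profileDeriv r ε s) s := by
  have hr : 0 < r := hε.trans hεr
  unfold profileDeriv
  split_ifs with a b c
  · refine (hasDerivAt_const s ((ε⁻¹) ^ 3)).congr_of_eventuallyEq ?_
    filter_upwards [Iio_mem_nhds a] with t ht using profile_of_lt hr hεr ht
  · have hs : 0 < s := by linarith
    have h : HasDerivAt (fun t : ℝ => (t ^ 3)⁻¹) (-3 / s ^ 4) s := by
      refine ((hasDerivAt_pow 3 s).inv (by positivity)).congr_deriv ?_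
      rw [← pow_mul, div_eq_div_iff (by positivity) (by positivity)]
      norm_num
      ring
    refine h.congr_of_eventuallyEq ?_
    filter_upwards [Ioi_mem_nhds ((not_lt.1 a).lt_of_ne' h1), Iio_mem_nhds b] with t ht ht'
    rw [profile_of_le (le_of_lt ht), weight, if_pos ((div_le_one hr).2 (le_of_lt ht')), one_div]
  · have hs : 0 < s := by linarith
    have h : HasDerivAt (fun t : ℝ => (2 - t / r) / t ^ 3)
        (-(1 / r) / s ^ 3 - 3 * (2 - s / r) / s ^ 4) s := by
      refine ((((hasDerivAt_id s).div_const r).const_sub 2).div (hasDerivAt_pow 3 s)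
        (by positivity)).congr_deriv ?_
      simp only [id]
      field_simp
      norm_num
      ring
    refine h.congr_of_eventuallyEq ?_
    filter_upwards [Ioi_mem_nhds ((not_lt.1 b).lt_of_ne' h2), Iio_mem_nhds c] with t ht ht'
    simp only [mem_Ioi, mem_Iio] at ht ht'
    rw [profile_of_le (by linarith), weight, if_neg (by rw [not_le, lt_div_iff₀ hr]; linarith),
      if_pos (by rw [div_le_iff₀ hr]; exact ht'.le)]
  · refine (hasDerivAt_const s 0).congr_of_eventuallyEq ?_
    filter_upwards [Ioi_mem_nhds ((not_lt.1 c).lt_of_ne' h3)] with t ht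
      using profile_eq_zero hr (le_of_lt ht)

/-- The integrand of the ball term, centred at the origin, for the increment field `V`. -/
noncomputable def centredBall (V : R3 → R3) (r : ℝ) (z : R3) : ℝ :=
  weight (‖z‖ / r) * ((3 * (inner ℝ z (V z)) ^ 2 / ‖z‖ ^ 2 - ‖V z‖ ^ 2) / ‖z‖ ^ 3)

/-- The tensor field `V ⊗ V + q I`. -/
noncomputable def stress (V : R3 → R3) (q : R3 → ℝ) (i j : Fin 3) (z : R3) : ℝ :=
  V z i * V z j + if i = j then q z else 0

theorem sum_mul_stress (V : R3 → R3) (q : R3 → ℝ) (a b : ℝ) (z : R3) :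
    ∑ i, ∑ j, (a * (z i * z j) + b * (if i = j then 1 else 0)) * stress V q i j z
      = a * ((inner ℝ z (V z)) ^ 2 + ‖z‖ ^ 2 * q z) + b * (‖V z‖ ^ 2 + 3 * q z) := by
  simp only [stress, EuclideanSpace.real_norm_sq_eq, PiLp.inner_apply, Fin.sum_univ_three,
    RCLike.inner_apply, conj_trivial]
  simp
  ring

theorem ae_norm_ne (s : ℝ) : ∀ᵐ z : R3, ‖z‖ ≠ s := by
  have : volume (Metric.sphere (0 : R3) s) = 0 := Measure.addHaar_sphere _ _ _
  filter_upwards [measure_eq_zero_iff_ae_notMem.1 this] with z hz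
  simpa using hz

/-- The coefficient of `q` is `s k' + 3 k` with `s = ‖z‖`. It equals `3 ε⁻³` inside the small ball,
vanishes where `k = s⁻³`, and on the annulus only the slope of the weight survives, giving `-1 / (r
s²)`. -/
theorem sum_lineDeriv_profile_mul_stress_eq (V : R3 → R3) (q : R3 → ℝ) {r ε : ℝ}
    (hε : 0 < ε) (hεr : ε < r) :
    ∀ᵐ z : R3, ∑ i, ∑ j, lineDeriv ℝ (fun z : R3 => profile r ε ‖z‖ * z i) z (basisVec j)
        * stress V q i j z
      = (ε⁻¹) ^ 3 * (Metric.ball 0 ε).indicator (fun z => ‖V z‖ ^ 2 + 3 * q z) z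
        - (Metric.closedBall 0 (2 * r) \ Metric.ball 0 ε).indicator (centredBall V r) z
        - 1 / r * ((annulus 0 r).indicator (fun z => (inner ℝ z (V z)) ^ 2 / ‖z‖ ^ 4) z
          + (annulus 0 r).indicator (fun z => q z / ‖z‖ ^ 2) z) := by
  have hr : 0 < r := hε.trans hεr
  -- The origin and the three spheres where the profile has corners are null sets.
  filter_upwards [ae_norm_ne 0, ae_norm_ne ε, ae_norm_ne r, ae_norm_ne (2 * r)] with z h0 h1 h2 h3
  have hz : z ≠ 0 := norm_ne_zero_iff.1 h0
  simp_rw [lineDeriv_radial_mul hz (hasDerivAt_profile hε hεr h1 h2 h3), sum_mul_stress]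
  unfold profileDeriv
  split_ifs with a b c
  · rw [profile_of_lt hr hεr a, indicator_of_mem (by simpa using a),
      indicator_of_notMem (by simp [a]),
      indicator_of_notMem (by simp [annulus]; intro; linarith),
      indicator_of_notMem (by simp [annulus]; intro; linarith)]
    ring
  · rw [profile_of_le (not_lt.1 a), indicator_of_notMem (by simpa using a),
      indicator_of_mem (by simp; constructor <;> linarith),
      indicator_of_notMem (by simp [annulus]; intro; linarith),
      indicator_of_notMem (by simp [annulus]; intro; linarith), centredBall, weight,
      if_pos ((div_le_one hr).2 b.le)]
    field_simp
    ring
  · rw [profile_of_le (not_lt.1 a), indicator_of_notMem (by simpa using a),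
      indicator_of_mem (by simp; constructor <;> linarith),
      indicator_of_mem (by simp [annulus]; constructor <;> linarith),
      indicator_of_mem (by simp [annulus]; constructor <;> linarith), centredBall, weight,
      if_neg (by rw [not_le, lt_div_iff₀ hr]; rw [not_lt] at b; rw [one_mul]; exact b.lt_of_ne' h2),
      if_pos (by rw [div_le_iff₀ hr]; exact c.le)]
    field_simp
    ring
  · have c' : 2 * r < ‖z‖ := (not_lt.1 c).lt_of_ne' h3
    rw [profile_eq_zero hr (not_lt.1 c), indicator_of_notMem (by simpa using a),
      indicator_of_notMem (by simp; intro; linarith),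
      indicator_of_notMem (by simp [annulus]; intro; linarith),
      indicator_of_notMem (by simp [annulus]; intro; linarith)]
    ring

/-! ### The identity at scale `ε` -/

theorem isCompact_annulus (x : R3) (r : ℝ) : IsCompact (annulus x r) := by
  refine (isCompact_closedBall x (2 * r)).of_isClosed_subset ?_ fun y hy => ?_
  · exact (isClosed_le continuous_const (by fun_prop : Continuous fun y : R3 => ‖y - x‖)).inter
      (isClosed_le (by fun_prop : Continuous fun y : R3 => ‖y - x‖) continuous_const)
  · simpa [dist_eq_norm] using hy.2

theorem measurableSet_annulus (x : R3) (r : ℝ) : MeasurableSet (annulus x r) :=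
  (isCompact_annulus x r).measurableSet

/-- The representation identity with the singularity regularized at scale `ε`. -/
theorem regularized_representation {V : R3 → R3} {q : R3 → ℝ} {r ε : ℝ}
    (hε : 0 < ε) (hεr : ε < r) (hV : ContDiff ℝ 2 V) (hq : ContDiff ℝ 2 q)
    (hdiv : ∀ z, ∑ i, ∑ j, partialDeriv i (partialDeriv j (stress V q i j)) z = 0)
    (hB : IntegrableOn (centredBall V r) (Metric.closedBall 0 (2 * r))) :
    (ε⁻¹) ^ 3 * (∫ z in Metric.ball 0 ε, (‖V z‖ ^ 2 + 3 * q z))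
      - (∫ z in Metric.closedBall 0 (2 * r) \ Metric.ball 0 ε, centredBall V r z)
      - 1 / r * ((∫ z in annulus 0 r, (inner ℝ z (V z)) ^ 2 / ‖z‖ ^ 4)
        + ∫ z in annulus 0 r, q z / ‖z‖ ^ 2) = 0 := by
  have hr : 0 < r := hε.trans hεr
  have hT : ∀ i j, ContDiff ℝ 2 (stress V q i j) := fun i j => by
    have hc : ∀ i, ContDiff ℝ 2 fun z => V z i := fun i => (contDiff_euclidean.1 hV) i
    refine ((hc i).mul (hc j)).add ?_
    split_ifs
    exacts [hq, contDiff_const]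
  have key := sum_integral_lineDeriv_profile_mul_eq_zero hr hε hT hdiv
  have hint : ∀ i j, Integrable fun z =>
      lineDeriv ℝ (fun z : R3 => profile r ε ‖z‖ * z i) z (basisVec j) * stress V q i j z := by
    intro i j
    obtain ⟨D, hD⟩ := exists_lipschitzWith_profile_mul hr hε i
    exact integrable_lineDeriv_mul hD (hasCompactSupport_profile_mul hr i) (hT i j).continuous _
  simp_rw [← integral_finsetSum _ fun j _ => hint _ j] at key
  rw [← integral_finsetSum _ fun i _ => integrable_finsetSum _ fun j _ => hint i j,
    integral_congr_ae (sum_lineDeriv_profile_mul_stress_eq V q hε hεr)] at key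
  have hVc := hV.continuous
  have hqc := hq.continuous
  have mA := measurableSet_annulus 0 r
  have hne : ∀ z ∈ annulus 0 r, ‖z‖ ≠ 0 := fun z hz => by
    have := hz.1
    rw [sub_zero] at this
    linarith
  have i1 : Integrable ((Metric.ball 0 ε).indicator (fun z => ‖V z‖ ^ 2 + 3 * q z)) :=
    (((by fun_prop : Continuous fun z => ‖V z‖ ^ 2 + 3 * q z).continuousOn.integrableOn_compact
      (isCompact_closedBall 0 ε)).mono_set Metric.ball_subset_closedBall).integrable_indicator
      Metric.isOpen_ball.measurableSet
  have m2 : MeasurableSet (Metric.closedBall (0 : R3) (2 * r) \ Metric.ball 0 ε) :=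
    Metric.isClosed_closedBall.measurableSet.diff Metric.isOpen_ball.measurableSet
  have i2 : Integrable
      ((Metric.closedBall 0 (2 * r) \ Metric.ball 0 ε).indicator (centredBall V r)) :=
    (hB.mono_set sdiff_subset).integrable_indicator m2
  have i3 : Integrable ((annulus 0 r).indicator fun z => (inner ℝ z (V z)) ^ 2 / ‖z‖ ^ 4) :=
    (ContinuousOn.integrableOn_compact (isCompact_annulus 0 r) (ContinuousOn.div (by fun_prop)
      (by fun_prop) fun z hz => pow_ne_zero _ (hne z hz))).integrable_indicator mA
  have i4 : Integrable ((annulus 0 r).indicator fun z => q z / ‖z‖ ^ 2) :=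
    (ContinuousOn.integrableOn_compact (isCompact_annulus 0 r) (ContinuousOn.div (by fun_prop)
      (by fun_prop) fun z hz => pow_ne_zero _ (hne z hz))).integrable_indicator mA
  have i12 : Integrable fun z =>
      (ε⁻¹) ^ 3 * (Metric.ball 0 ε).indicator (fun z => ‖V z‖ ^ 2 + 3 * q z) z
        - (Metric.closedBall 0 (2 * r) \ Metric.ball 0 ε).indicator (centredBall V r) z :=
    (i1.const_mul _).sub i2
  have i34 : Integrable fun z =>
      (annulus 0 r).indicator (fun z => (inner ℝ z (V z)) ^ 2 / ‖z‖ ^ 4) z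
        + (annulus 0 r).indicator (fun z => q z / ‖z‖ ^ 2) z := i3.add i4
  rw [integral_sub i12 (i34.const_mul _),
    integral_sub (i1.const_mul _) i2, integral_const_mul, integral_const_mul,
    integral_add i3 i4, integral_indicator Metric.isOpen_ball.measurableSet,
    integral_indicator m2, integral_indicator mA, integral_indicator mA] at key
  exact key

/-! ### Polar coordinates and spherical means -/

/-- Integration in polar coordinates. -/
theorem integral_eq_integral_Ioi_integral_sphere {F : R3 → ℝ} (hF : Integrable F) :
    ∫ z, F z = ∫ ρ in Ioi (0 : ℝ),
      ρ ^ 2 * ∫ ξ : Metric.sphere (0 : R3) 1, F (ρ • (ξ : R3)) ∂(volume : Measure R3).toSphere := by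
  have hdim : Module.finrank ℝ R3 - 1 = 2 := by simp
  have mp := (volume : Measure R3).measurePreserving_homeomorphUnitSphereProd
  rw [hdim] at mp
  have me := (homeomorphUnitSphereProd R3).measurableEmbedding
  let G : Metric.sphere (0 : R3) 1 × Ioi (0 : ℝ) → ℝ := fun a => F (a.2.1 • (a.1 : R3))
  have hG : ∀ z : ({0}ᶜ : Set R3), G (homeomorphUnitSphereProd R3 z) = F z := by
    intro z
    have hz : ‖(z : R3)‖ ≠ 0 := norm_ne_zero_iff.2 z.2
    simp [G, smul_smul, hz]
  have hGi : Integrable G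
      ((volume : Measure R3).toSphere.prod (Measure.volumeIoiPow 2)) := by
    rw [← mp.integrable_comp_emb me]
    have h1 : G ∘ homeomorphUnitSphereProd R3 = F ∘ ((↑) : ({0}ᶜ : Set R3) → R3) := funext hG
    rw [h1, ← integrableOn_iff_comap_subtypeVal (measurableSet_singleton _).compl]
    exact hF.integrableOn
  calc ∫ z, F z = ∫ z : ({0}ᶜ : Set R3), F z ∂(volume.comap Subtype.val) := by
        rw [integral_subtype_comap (measurableSet_singleton _).compl F, restrict_compl_singleton]
    _ = ∫ a, G a ∂(volume : Measure R3).toSphere.prod (Measure.volumeIoiPow 2) := by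
        rw [← mp.integral_comp me]
        simp_rw [hG]
    _ = ∫ ρ : Ioi (0 : ℝ), (∫ ξ : Metric.sphere (0 : R3) 1, F (ρ.1 • (ξ : R3))
          ∂(volume : Measure R3).toSphere) ∂(Measure.volumeIoiPow 2) :=
        integral_prod_symm _ hGi
    _ = _ := by
        simp only [Measure.volumeIoiPow, ENNReal.ofReal]
        rw [integral_withDensity_eq_integral_smul
          ((measurable_subtype_coe.pow_const _).real_toNNReal),
          integral_subtype_comap measurableSet_Ioi fun a : ℝ => Real.toNNReal (a ^ 2) •
            ∫ ξ : Metric.sphere (0 : R3) 1, F (a • (ξ : R3)) ∂(volume : Measure R3).toSphere]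
        refine setIntegral_congr_fun measurableSet_Ioi fun ρ hρ => ?_
        simp only [NNReal.smul_def, smul_eq_mul]
        rw [Real.coe_toNNReal _ (sq_nonneg ρ)]

theorem toSphere_real_univ : (volume : Measure R3).toSphere.real univ = 4 * Real.pi := by
  rw [Measure.toSphere_real_apply_univ, measureReal_def, EuclideanSpace.volume_ball_fin_three]
  have : 0 ≤ Real.pi * 4 / 3 := by positivity
  simp [ENNReal.toReal_ofReal this, mul_comm]
  ring

theorem sphericalMean_eq (f : R3 → ℝ) (x : R3) (ρ : ℝ) :
    sphericalMean f x ρ = (4 * Real.pi)⁻¹ *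
      ∫ ξ : Metric.sphere (0 : R3) 1, f (x + ρ • (ξ : R3)) ∂(volume : Measure R3).toSphere := by
  rw [sphericalMean, average_eq, toSphere_real_univ, smul_eq_mul]

theorem continuous_sphericalMean {f : R3 → ℝ} (hf : Continuous f) (x : R3) :
    Continuous (sphericalMean f x) := by
  simp_rw [funext (sphericalMean_eq f x)]
  refine continuous_const.mul ?_
  have := continuous_parametric_integral_of_continuous (μ := (volume : Measure R3).toSphere)
    (f := fun (ρ : ℝ) (ξ : Metric.sphere (0 : R3) 1) => f (x + ρ • (ξ : R3)))
    (by simp only [Function.uncurry_def]; fun_prop) isCompact_univ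
  simpa using this

theorem ne_zero_of_mem_annulus {r : ℝ} (hr : 0 < r) {z : R3} (hz : z ∈ annulus 0 r) :
    ‖z‖ ≠ 0 := by
  have := hz.1
  rw [sub_zero] at this
  linarith

/-- The polar Jacobian `ρ ^ 2` cancels `‖z‖ ^ 2`, leaving an unweighted integral over radii. -/
theorem integral_annulus_div_norm_sq {p : R3 → ℝ} (hp : Continuous p) (x : R3) {r : ℝ}
    (hr : 0 < r) :
    ∫ z in annulus 0 r, p (x + z) / ‖z‖ ^ 2
      = 4 * Real.pi * ∫ ρ in r..(2 * r), sphericalMean p x ρ := by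
  have mA := measurableSet_annulus 0 r
  have hi : Integrable ((annulus 0 r).indicator fun z => p (x + z) / ‖z‖ ^ 2) :=
    (ContinuousOn.integrableOn_compact (isCompact_annulus 0 r) (ContinuousOn.div (by fun_prop)
      (by fun_prop) fun z hz => pow_ne_zero _ (ne_zero_of_mem_annulus hr hz))).integrable_indicator
      mA
  rw [← integral_indicator mA, integral_eq_integral_Ioi_integral_sphere hi,
    intervalIntegral.integral_of_le (by linarith), ← integral_Icc_eq_integral_Ioc,
    ← integral_const_mul]
  have : ∀ ρ ∈ Ioi (0 : ℝ), ρ ^ 2 * ∫ ξ : Metric.sphere (0 : R3) 1,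
      (annulus 0 r).indicator (fun z => p (x + z) / ‖z‖ ^ 2) (ρ • (ξ : R3))
        ∂(volume : Measure R3).toSphere
      = (Icc r (2 * r)).indicator (fun ρ => 4 * Real.pi * sphericalMean p x ρ) ρ := by
    intro ρ hρ
    have hρ' : (0 : ℝ) < ρ := hρ
    have hn : ∀ ξ : Metric.sphere (0 : R3) 1, ‖ρ • (ξ : R3)‖ = ρ := fun ξ => by
      simp [norm_smul, abs_of_pos hρ']
    have hm : ∀ ξ : Metric.sphere (0 : R3) 1, ρ • (ξ : R3) ∈ annulus 0 r ↔ ρ ∈ Icc r (2 * r) :=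
      fun ξ => by simp [annulus, hn]
    by_cases h : ρ ∈ Icc r (2 * r)
    · simp_rw [indicator_of_mem ((hm _).2 h), hn, indicator_of_mem h]
      rw [integral_div, sphericalMean_eq]
      have := Real.pi_pos
      field_simp
    · simp_rw [indicator_of_notMem (fun h' => h ((hm _).1 h')), indicator_of_notMem h]
      simp
  rw [setIntegral_congr_fun measurableSet_Ioi this, setIntegral_indicator measurableSet_Icc,
    inter_eq_self_of_subset_right (Icc_subset_Ioi_iff (by linarith) |>.2 hr)]

/-! ### Absolute convergence of the singular integral -/

/-- In polar coordinates the integrand becomes `s ^ 2 * s⁻¹ = s`, which is integrable on bounded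
intervals. -/
theorem integrableOn_inv_norm (R : ℝ) :
    IntegrableOn (fun z : R3 => ‖z‖⁻¹) (Metric.closedBall 0 R) := by
  have h : Integrable fun z : R3 => (Iic R).indicator (fun s : ℝ => s⁻¹) ‖z‖ := by
    rw [integrable_fun_norm_addHaar volume (f := (Iic R).indicator fun s : ℝ => s⁻¹)]
    have h1 : IntegrableOn (fun s : ℝ => s) (Ioi 0 ∩ Iic R) := by
      rw [Ioi_inter_Iic]
      exact (continuous_id.integrableOn_Icc (a := 0) (b := R)).mono_set Ioc_subset_Icc_self
    have h2 := (integrableOn_indicator_iff (s := Iic R) (t := Ioi (0 : ℝ)) (f := fun s : ℝ => s)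
      measurableSet_Iic).2 (by rwa [inter_comm])
    refine h2.congr_fun (fun s hs => ?_) measurableSet_Ioi
    have hs' : s ≠ 0 := (mem_Ioi.1 hs).ne'
    by_cases hsR : s ∈ Iic R
    · simp [indicator_of_mem hsR]
      field_simp
    · simp [indicator_of_notMem hsR]
  refine (h.integrableOn (s := Metric.closedBall 0 R)).congr_fun (fun z hz => ?_)
    Metric.isClosed_closedBall.measurableSet
  exact indicator_of_mem (by simpa using hz) _

/-- Linear growth of `V` turns the `‖z‖⁻³` singularity into `‖z‖⁻¹`; by Cauchy–Schwarz the numerator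
is at most `(3 + 1) ‖V z‖ ^ 2`. -/
theorem abs_centredBall_le {V : R3 → R3} {r K : ℝ} {z : R3} (hV : ‖V z‖ ≤ K * ‖z‖) :
    |centredBall V r z| ≤ 4 * K ^ 2 * ‖z‖⁻¹ := by
  rcases eq_or_ne z 0 with rfl | hz
  · simp [centredBall]
  have hpos : 0 < ‖z‖ := norm_pos_iff.2 hz
  obtain ⟨hw0, hw1⟩ : 0 ≤ weight (‖z‖ / r) ∧ weight (‖z‖ / r) ≤ 1 := by
    rw [weight_eq]; exact ⟨le_max_left _ _, max_le zero_le_one (min_le_left _ _)⟩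
  have hsq : ‖V z‖ ^ 2 ≤ K ^ 2 * ‖z‖ ^ 2 := by
    rw [← mul_pow]; exact pow_le_pow_left₀ (norm_nonneg _) hV 2
  have hin : (inner ℝ z (V z)) ^ 2 / ‖z‖ ^ 2 ≤ ‖V z‖ ^ 2 := by
    rw [div_le_iff₀ (by positivity), ← mul_pow, mul_comm]
    exact sq_le_sq' (neg_le_of_abs_le (abs_real_inner_le_norm _ _)) (real_inner_le_norm _ _)
  have hin0 : 0 ≤ (inner ℝ z (V z)) ^ 2 / ‖z‖ ^ 2 := by positivity
  have h1 : |3 * (inner ℝ z (V z)) ^ 2 / ‖z‖ ^ 2 - ‖V z‖ ^ 2| ≤ 4 * K ^ 2 * ‖z‖ ^ 2 := by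
    rw [mul_div_assoc, abs_le]
    constructor <;> nlinarith [sq_nonneg ‖V z‖]
  calc |centredBall V r z|
      = weight (‖z‖ / r) * (|3 * (inner ℝ z (V z)) ^ 2 / ‖z‖ ^ 2 - ‖V z‖ ^ 2| / ‖z‖ ^ 3) := by
        rw [centredBall, abs_mul, abs_div, abs_of_nonneg hw0, abs_of_pos (pow_pos hpos 3)]
    _ ≤ 1 * ((4 * K ^ 2 * ‖z‖ ^ 2) / ‖z‖ ^ 3) := by gcongr
    _ = _ := by field_simp

theorem integrableOn_centredBall {V : R3 → R3} (hV : ContDiff ℝ 1 V) (hV0 : V 0 = 0) (r : ℝ) :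
    IntegrableOn (centredBall V r) (Metric.closedBall 0 (2 * r)) := by
  -- `K` bounds the derivative on the convex ball, so the mean value inequality from `0`, with `V 0
  -- = 0`, gives the linear growth.
  obtain ⟨K, hK⟩ := (isCompact_closedBall (0 : R3) (2 * r)).exists_bound_of_continuousOn
    (hV.continuous_fderiv one_ne_zero).continuousOn
  have hlip : ∀ z ∈ Metric.closedBall (0 : R3) (2 * r), ‖V z‖ ≤ K * ‖z‖ := by
    intro z hz
    have h0 : (0 : R3) ∈ Metric.closedBall (0 : R3) (2 * r) :=
      Metric.mem_closedBall_self (Metric.nonneg_of_mem_closedBall hz)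
    simpa [hV0] using (convex_closedBall (0 : R3) (2 * r)).norm_image_sub_le_of_norm_fderiv_le
      (fun y _ => hV.differentiable one_ne_zero y) hK h0 hz
  refine ((integrableOn_inv_norm (2 * r)).const_mul (4 * K ^ 2)).mono' ?_ ?_
  · have hw : Measurable weight := by
      obtain ⟨-, C, hC⟩ := isBoundedLipschitz_weight
      exact hC.continuous.measurable
    have hVm := hV.continuous.measurable
    have : Measurable (centredBall V r) := by
      unfold centredBall
      fun_prop
    exact this.aestronglyMeasurable
  · filter_upwards [ae_restrict_mem Metric.isClosed_closedBall.measurableSet] with z hz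
    exact abs_centredBall_le (hlip z hz)

/-! ### The limit `ε → 0` -/

/-- Averages of a continuous function over shrinking balls. -/
theorem tendsto_inv_pow_mul_integral_ball {f : R3 → ℝ} (hf : Continuous f) :
    Tendsto (fun ε : ℝ => (ε⁻¹) ^ 3 * ∫ z in Metric.ball 0 ε, f z) (𝓝[>] 0)
      (𝓝 (4 * Real.pi / 3 * f 0)) := by
  have hvol : ∀ᶠ ε in 𝓝[>] (0 : ℝ),
      volume.real (Metric.ball (0 : R3) ε) = ε ^ 3 * (Real.pi * 4 / 3) := by
    filter_upwards [self_mem_nhdsWithin] with ε hε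
    have := Real.pi_pos
    rw [measureReal_def, EuclideanSpace.volume_ball_fin_three, ENNReal.toReal_mul,
      ENNReal.toReal_pow, ENNReal.toReal_ofReal (le_of_lt hε), ENNReal.toReal_ofReal (by positivity)]
  have hs : Tendsto (fun ε : ℝ => Metric.ball (0 : R3) ε) (𝓝[>] 0) (𝓝 0).smallSets := by
    refine tendsto_smallSets_iff.2 fun t ht => ?_
    obtain ⟨δ, hδ, hsub⟩ := Metric.mem_nhds_iff.1 ht
    filter_upwards [Ioo_mem_nhdsGT hδ] with ε hε
    exact (Metric.ball_subset_ball hε.2.le).trans hsub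
  have key := (hf.continuousAt (x := 0)).integral_sub_linear_isLittleO_ae (μ := volume)
    (hf.stronglyMeasurableAtFilter _ _) hs _ hvol
  have h2 := key.tendsto_div_nhds_zero
  have h3 := (h2.const_mul (Real.pi * 4 / 3)).add_const (4 * Real.pi / 3 * f 0)
  simp only [mul_zero, zero_add] at h3
  refine h3.congr' ?_
  filter_upwards [self_mem_nhdsWithin] with ε hε
  have hε' : (0 : ℝ) < ε := hε
  have := Real.pi_pos
  simp only [smul_eq_mul]
  field_simp
  ring

/-- Dominated convergence: every `z ≠ 0` leaves the removed ball once `ε < ‖z‖`. -/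
theorem tendsto_integral_diff_ball {B : R3 → ℝ} {s : Set R3} (hs : MeasurableSet s)
    (hB : IntegrableOn B s) :
    Tendsto (fun ε : ℝ => ∫ z in s \ Metric.ball 0 ε, B z) (𝓝[>] 0) (𝓝 (∫ z in s, B z)) := by
  have hm : ∀ ε : ℝ, MeasurableSet (s \ Metric.ball 0 ε) := fun ε =>
    hs.diff Metric.isOpen_ball.measurableSet
  simp_rw [← integral_indicator (hm _), ← integral_indicator hs]
  refine tendsto_integral_filter_of_dominated_convergence (fun z => ‖s.indicator B z‖)
    (Eventually.of_forall fun ε =>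
      ((hB.mono_set sdiff_subset).integrable_indicator (hm ε)).aestronglyMeasurable)
    (Eventually.of_forall fun ε => ae_of_all _ fun z =>
      norm_indicator_le_of_subset sdiff_subset _ _)
    (hB.integrable_indicator hs).norm ?_
  filter_upwards [ae_norm_ne 0] with z hz
  refine tendsto_const_nhds.congr' ?_
  filter_upwards [Ioo_mem_nhdsGT ((norm_nonneg z).lt_of_ne' hz)] with ε hε
  have : z ∉ Metric.ball 0 ε := by simpa using hε.2.le
  by_cases h : z ∈ s <;> simp [indicator, h, this]

/-- The representation identity centred at the origin. -/
theorem centred_representation {V : R3 → R3} {q : R3 → ℝ} {r : ℝ}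
    (hr : 0 < r) (hV : ContDiff ℝ 2 V) (hV0 : V 0 = 0) (hq : ContDiff ℝ 2 q)
    (hdiv : ∀ z, ∑ i, ∑ j, partialDeriv i (partialDeriv j (stress V q i j)) z = 0) :
    4 * Real.pi * q 0 - (∫ z in Metric.closedBall 0 (2 * r), centredBall V r z)
      - 1 / r * ((∫ z in annulus 0 r, (inner ℝ z (V z)) ^ 2 / ‖z‖ ^ 4)
        + ∫ z in annulus 0 r, q z / ‖z‖ ^ 2) = 0 := by
  have hB := integrableOn_centredBall (hV.of_le one_le_two) hV0 r
  have hVc := hV.continuous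
  have hqc := hq.continuous
  have t1 := tendsto_inv_pow_mul_integral_ball (f := fun z => ‖V z‖ ^ 2 + 3 * q z) (by fun_prop)
  have t2 := tendsto_integral_diff_ball Metric.isClosed_closedBall.measurableSet hB
  have t := (t1.sub t2).sub_const (1 / r * ((∫ z in annulus 0 r, (inner ℝ z (V z)) ^ 2 / ‖z‖ ^ 4)
        + ∫ z in annulus 0 r, q z / ‖z‖ ^ 2))
  have h0 := t.congr' (f₂ := fun _ => (0 : ℝ)) (by
    filter_upwards [Ioo_mem_nhdsGT hr] with ε hε
    exact regularized_representation hε.1 hε.2 hV hq hdiv hB)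
  have := tendsto_nhds_unique h0 tendsto_const_nhds
  rw [← this, hV0]
  simp
  ring

/-! ### Double divergence of the increment stress -/

theorem partialDeriv_add {f g : R3 → ℝ} (hf : Differentiable ℝ f) (hg : Differentiable ℝ g)
    (i : Fin 3) :
    partialDeriv i (fun y => f y + g y) = fun y => partialDeriv i f y + partialDeriv i g y := by
  funext y
  simp only [partialDeriv]
  rw [fderiv_fun_add (hf y) (hg y)]
  rfl

theorem partialDeriv_const_mul {f : R3 → ℝ} (hf : Differentiable ℝ f) (c : ℝ) (i : Fin 3) :
    partialDeriv i (fun y => c * f y) = fun y => c * partialDeriv i f y := by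
  funext y
  simp only [partialDeriv]
  rw [fderiv_const_mul (hf y)]
  rfl

theorem partialDeriv_const (c : ℝ) (i : Fin 3) :
    partialDeriv i (fun _ => c) = fun _ => 0 := by
  funext y
  simp [partialDeriv]

theorem partialDeriv_comp_const_add (f : R3 → ℝ) (x : R3) (i : Fin 3) :
    partialDeriv i (fun z => f (x + z)) = fun z => partialDeriv i f (x + z) := by
  funext z
  simp only [partialDeriv]
  rw [fderiv_comp_add_left]

theorem differentiable_partialDeriv {f : R3 → ℝ} (hf : ContDiff ℝ 2 f) (i : Fin 3) :
    Differentiable ℝ (partialDeriv i f) :=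
  (contDiff_partialDeriv (n := 1) hf i).differentiable one_ne_zero

theorem partialDeriv_partialDeriv {f : R3 → ℝ} (hf : ContDiff ℝ 2 f) (i j : Fin 3) (x : R3) :
    partialDeriv i (partialDeriv j f) x
      = fderiv ℝ (fderiv ℝ f) x (basisVec i) (basisVec j) := by
  have h : DifferentiableAt ℝ (fderiv ℝ f) x :=
    (hf.fderiv_right (m := 1) le_rfl).differentiable one_ne_zero x
  have := (h.hasFDerivAt.clm_apply (hasFDerivAt_const (basisVec j) x)).fderiv
  change fderiv ℝ (fun y => fderiv ℝ f y (basisVec j)) x (basisVec i) = _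
  rw [this]
  simp

theorem partialDeriv_comm {f : R3 → ℝ} (hf : ContDiff ℝ 2 f) (i j : Fin 3) (x : R3) :
    partialDeriv i (partialDeriv j f) x = partialDeriv j (partialDeriv i f) x := by
  rw [partialDeriv_partialDeriv hf, partialDeriv_partialDeriv hf]
  exact (hf.contDiffAt.isSymmSndFDerivAt (by simp)).eq _ _

theorem laplacian_eq_sum_partialDeriv {f : R3 → ℝ} (hf : ContDiff ℝ 2 f) (x : R3) :
    Laplacian.laplacian f x = ∑ i, partialDeriv i (partialDeriv i f) x := by
  rw [InnerProductSpace.laplacian_eq_iteratedFDeriv_orthonormalBasis f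
    (EuclideanSpace.basisFun (Fin 3) ℝ)]
  refine Finset.sum_congr rfl fun i _ => ?_
  rw [partialDeriv_partialDeriv hf, iteratedFDeriv_two_apply]
  simp

theorem sum_partialDeriv_partialDeriv_eq_zero {u : R3 → R3} (hu : ∀ j, ContDiff ℝ 2 fun y => u y j)
    (hdiv : ∀ x, divergence u x = 0) (i : Fin 3) (x : R3) :
    ∑ j, partialDeriv i (partialDeriv j fun y => u y j) x = 0 := by
  have h : (fun y => ∑ j, partialDeriv j (fun y => u y j) y) = fun _ => 0 := funext hdiv
  have h2 := congrFun (congrArg (partialDeriv i) h) x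
  rw [partialDeriv_const] at h2
  refine Eq.trans ?_ h2
  change _ = fderiv ℝ (fun y => ∑ j, partialDeriv j (fun y => u y j) y) x (basisVec i)
  rw [fderiv_fun_sum fun j _ => differentiable_partialDeriv (hu j) j x,
    _root_.sum_apply]
  rfl

/-- The stress tensor of the velocity increments has vanishing double divergence. -/
theorem sum_partialDeriv_stress_eq_zero {u : R3 → R3} {p : R3 → ℝ} (hu : ContDiff ℝ 2 u)
    (hdiv : ∀ x, divergence u x = 0) (hp : IsPressure u p) (x z : R3) :
    ∑ i, ∑ j, partialDeriv i (partialDeriv j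
      (stress (fun z => u (x + z) - u x) (fun z => p (x + z)) i j)) z = 0 := by
  have hc : ∀ i, ContDiff ℝ 2 fun y => u y i := fun i => (contDiff_euclidean.1 hu) i
  have hcd : ∀ i, Differentiable ℝ fun y => u y i := fun i => (hc i).differentiable two_ne_zero
  have hpd : Differentiable ℝ p := hp.1.differentiable two_ne_zero
  have key : ∀ i j, partialDeriv i (partialDeriv j
      (stress (fun z => u (x + z) - u x) (fun z => p (x + z)) i j)) z
      = partialDeriv i (partialDeriv j fun y => u y i * u y j) (x + z)
        + -u x j * partialDeriv i (partialDeriv j fun y => u y i) (x + z)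
        + -u x i * partialDeriv i (partialDeriv j fun y => u y j) (x + z)
        + (if i = j then 1 else 0) * partialDeriv i (partialDeriv j p) (x + z) := by
    intro i j
    have hm : ContDiff ℝ 2 fun y => u y i * u y j := (hc i).mul (hc j)
    have hmd := hm.differentiable two_ne_zero
    have d1 := (hcd i).const_mul (-u x j)
    have d2 := (hcd j).const_mul (-u x i)
    have d3 := hpd.const_mul (if i = j then (1 : ℝ) else 0)
    have d4 : Differentiable ℝ fun _ : R3 => u x i * u x j := differentiable_const _
    have e1 := (differentiable_partialDeriv (hc i) j).const_mul (-u x j)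
    have e2 := (differentiable_partialDeriv (hc j) j).const_mul (-u x i)
    have e3 := (differentiable_partialDeriv hp.1 j).const_mul (if i = j then (1 : ℝ) else 0)
    have e0 := differentiable_partialDeriv hm j
    -- The product of increments is expanded with `u x` frozen as a coefficient; the linear terms
    -- are killed by incompressibility and the constant one by differentiation.
    obtain ⟨F, hF⟩ : ∃ F : R3 → ℝ, F = fun y => u y i * u y j + -u x j * u y i + -u x i * u y j
        + (if i = j then 1 else 0) * p y + u x i * u x j := ⟨_, rfl⟩
    have hs : stress (fun z => u (x + z) - u x) (fun z => p (x + z)) i j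
        = fun z => F (x + z) := by
      funext z
      simp only [hF, stress, PiLp.sub_apply]
      split_ifs <;> ring
    rw [hs, partialDeriv_comp_const_add F, partialDeriv_comp_const_add (partialDeriv j F), hF,
      partialDeriv_add (((hmd.fun_add d1).fun_add d2).fun_add d3) d4, partialDeriv_const,
      partialDeriv_add ((hmd.fun_add d1).fun_add d2) d3, partialDeriv_add (hmd.fun_add d1) d2,
      partialDeriv_add hmd d1, partialDeriv_const_mul (hcd i), partialDeriv_const_mul (hcd j),
      partialDeriv_const_mul hpd]
    simp only [add_zero]
    rw [partialDeriv_add ((e0.fun_add e1).fun_add e2) e3, partialDeriv_add (e0.fun_add e1) e2,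
      partialDeriv_add e0 e1, partialDeriv_const_mul (differentiable_partialDeriv (hc i) j),
      partialDeriv_const_mul (differentiable_partialDeriv (hc j) j),
      partialDeriv_const_mul (differentiable_partialDeriv hp.1 j)]
  simp_rw [key, Finset.sum_add_distrib]
  have s1 : ∑ i, ∑ j, -u x j * partialDeriv i (partialDeriv j fun y => u y i) (x + z) = 0 := by
    rw [Finset.sum_comm]
    refine Finset.sum_eq_zero fun j _ => ?_
    -- Symmetry of second derivatives puts `∂ᵢ` directly on `uᵢ`, so that the sum over `i` is a
    -- derivative of the divergence.
    simp_rw [fun i => partialDeriv_comm (hc i) i j (x + z)]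
    rw [← Finset.mul_sum, sum_partialDeriv_partialDeriv_eq_zero hc hdiv, mul_zero]
  have s2 : ∑ i, ∑ j, -u x i * partialDeriv i (partialDeriv j fun y => u y j) (x + z) = 0 := by
    refine Finset.sum_eq_zero fun i _ => ?_
    rw [← Finset.mul_sum, sum_partialDeriv_partialDeriv_eq_zero hc hdiv, mul_zero]
  have s3 : ∑ i, ∑ j, (if i = j then (1 : ℝ) else 0) * partialDeriv i (partialDeriv j p) (x + z)
      = Laplacian.laplacian p (x + z) := by
    rw [laplacian_eq_sum_partialDeriv hp.1]
    simp
  rw [s1, s2, s3, ← hp.2 (x + z)]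
  ring

/-! ### Translation back to the base point -/

/-- Contracting `σ` with `V ⊗ V` gives `3 (ẑ · V)² - |V|²`. Since `σ` is even, the direction `x - y`
may replace `y - x`; at `z = 0` both sides are `0` by the convention for division by zero. -/
theorem ballIntegrand_add (u : R3 → R3) (x : R3) (r : ℝ) (z : R3) :
    ballIntegrand u x r (x + z) = centredBall (fun z => u (x + z) - u x) r z := by
  rcases eq_or_ne z 0 with rfl | hz
  · simp [ballIntegrand, centredBall]
  have hn : ‖z‖ ≠ 0 := norm_ne_zero_iff.2 hz
  have h : x - (x + z) = -z := by abel
  rw [ballIntegrand, centredBall, h, add_sub_cancel_left, norm_neg]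
  congr 1
  rw [EuclideanSpace.real_norm_sq_eq (u (x + z) - u x)]
  simp only [sigma, unitVec, PiLp.inner_apply, Fin.sum_univ_three, RCLike.inner_apply, conj_trivial,
    PiLp.sub_apply, PiLp.smul_apply, PiLp.neg_apply, norm_neg, smul_eq_mul]
  simp
  field_simp
  ring

theorem annulusIntegrand_add (u : R3 → R3) (x z : R3) :
    annulusIntegrand u x (x + z) = (inner ℝ z (u (x + z) - u x)) ^ 2 / ‖z‖ ^ 4 := by
  rw [annulusIntegrand, add_sub_cancel_left, unitVec, real_inner_smul_left, mul_pow, inv_pow]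
  rcases eq_or_ne z 0 with rfl | hz
  · simp
  have hn : ‖z‖ ≠ 0 := norm_ne_zero_iff.2 hz
  field_simp

theorem preimage_annulus (x : R3) (r : ℝ) : (fun z => x + z) ⁻¹' annulus x r = annulus 0 r := by
  ext z
  simp [annulus]

theorem setIntegral_preimage_const_add (x : R3) (f : R3 → ℝ) (s : Set R3) :
    ∫ z in (fun z => x + z) ⁻¹' s, f (x + z) = ∫ y in s, f y :=
  (measurePreserving_add_left volume x).setIntegral_preimage_emb (measurableEmbedding_addLeft x) f s

theorem integrableOn_preimage_const_add (x : R3) (f : R3 → ℝ) (s : Set R3) :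
    IntegrableOn (fun z => f (x + z)) ((fun z => x + z) ⁻¹' s) ↔ IntegrableOn f s :=
  (measurePreserving_add_left volume x).integrableOn_comp_preimage (measurableEmbedding_addLeft x)

end LocalPressure

theorem mainTheorem1 (u : LocalPressure.R3 → LocalPressure.R3) (p : LocalPressure.R3 → ℝ)
    (hu : ContDiff ℝ 2 u) (huL2 : MemLp u 2 volume)
    (hdiv : ∀ x, LocalPressure.divergence u x = 0)
    (hp : LocalPressure.IsPressure u p)
    (x : LocalPressure.R3) (r : ℝ) (hr : 0 < r) :
    IntervalIntegrable (LocalPressure.sphericalMean p x) volume r (2 * r) ∧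
    IntegrableOn (LocalPressure.annulusIntegrand u x) (LocalPressure.annulus x r) volume ∧
    IntegrableOn (LocalPressure.ballIntegrand u x r) (Metric.closedBall x (2 * r)) volume ∧
    p x = LocalPressure.radialAverage p x r + LocalPressure.incrementTerm u x r := by
  open LocalPressure in
  have hV : ContDiff ℝ 2 fun z => u (x + z) - u x :=
    (hu.comp (contDiff_const.add contDiff_id)).sub contDiff_const
  have hV0 : (fun z => u (x + z) - u x) 0 = 0 := by simp
  have hq : ContDiff ℝ 2 fun z => p (x + z) := hp.1.comp (contDiff_const.add contDiff_id)
  have hball : (fun z => x + z) ⁻¹' Metric.closedBall x (2 * r) = Metric.closedBall 0 (2 * r) := by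
    simp
  refine ⟨(continuous_sphericalMean hp.1.continuous x).intervalIntegrable _ _, ?_, ?_, ?_⟩
  · rw [← integrableOn_preimage_const_add x, preimage_annulus]
    simp_rw [annulusIntegrand_add]
    have := hV.continuous
    exact ContinuousOn.integrableOn_compact (isCompact_annulus 0 r) (ContinuousOn.div (by fun_prop)
      (by fun_prop) fun z hz => pow_ne_zero _ (ne_zero_of_mem_annulus hr hz))
  · rw [← integrableOn_preimage_const_add x, hball]
    simp_rw [ballIntegrand_add]
    exact integrableOn_centredBall (hV.of_le one_le_two) hV0 r
  · have key := centred_representation hr hV hV0 hq (sum_partialDeriv_stress_eq_zero hu hdiv hp x)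
    rw [integral_annulus_div_norm_sq hp.1.continuous x hr, add_zero] at key
    rw [radialAverage, incrementTerm, ← setIntegral_preimage_const_add x (annulusIntegrand u x),
      ← setIntegral_preimage_const_add x (ballIntegrand u x r), preimage_annulus, hball]
    simp_rw [annulusIntegrand_add, ballIntegrand_add]
    have hpi := Real.pi_pos
    field_simp at key ⊢
    linarith
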